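/- Let $X, Y, X', Y'$ be Hausdorff, connected, locally path connected topological spaces, let $Y$ and $Y'$ be semilocally simply connected, let $B\subset Y$ and $B'\subset Y'$ be nonempty subsets, and let $f\colon X\to Y$ and $f'\colon X'\to Y'$ be continuous maps. Two points $x_0,x_1\in f^{-1}(B)$ are Nielsen equivalent if there are a path $\alpha$ in $X$ from $x_0$ to $x_1$ and a path $\beta$ in $B$ from $f(x_0)$ to $f(x_1)$ such that $f\alpha$ and $\beta$ are homotopic in $Y$ relative to end points; the equivalence classes are called Nielsen classes of $f$ (with respect to $B$). Given a homotopy $\{f_t\}_{t\in[0,1]}\colon X\to Y$, a Nielsen class $A_0$ of $f_0$ is $\{f_t\}$-related to a Nielsen class $A_1$ of $f_1$ if for some (equivalently, all) $x_0\in A_0$, $x_1\in A_1$ there are a path $\alpha$ in $X$ from $x_0$ to $x_1$ and a path $\beta$ in $B$ from $f_0(x_0)$ to $f_1(x_1)$ such that the path $t\mapsto f_t(\alpha(t))$ is homotopic in $Y$ to $\beta$ relative to end points. A Nielsen class $A_0$ of $f$ is topologically essential if for every homotopy $\{f_t\}$ with $f_0=f$ there is a Nielsen class of $f_1$ that is $\{f_t\}$-related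 to $A_0$. The topological Nielsen number $N_t(f,B)\in\{0,1,2,\dots,\infty\}$ is the number of topologically essential Nielsen classes of $f$. A map of triples $(Y,Y-B,B)\to(Y',Y'-B',B')$ is a continuous map $\psi\colon Y\to Y'$ with $\psi(B)\subset B'$ and $\psi(Y-B)\subset Y'-B'$. It is a homotopy equivalence of triples if there is a map of triples $\theta$ in the opposite direction such that $\theta\psi$ and $\psi\theta$ are homotopic to $\mathrm{id}_Y$ and $\mathrm{id}_{Y'}$ through maps of triples, and a homeomorphism of triples if it is a homeomorphism whose inverse is also a map of triples. Then: (1) If $\varphi\colon X\to X'$ is a homotopy equivalence, $\psi\colon (Y,Y-B,B)\to(Y',Y'-B',B')$ is a homotopy equivalence of triples, and $\psi f$ is homotopic to $f'\varphi$ as maps $X\to Y'$, then $N_t(f,B)=N_t(f',B')$. (2) In particular, if $\varphi\colon X\to X'$ is a homeomorphism, $\psi\colon (Y,Y-B,B)\to(Y',Y'-B',B')$ is a homeomorphism of triples, and $\psi f=f'\varphi$, then $N_t(f,B)=N_t(f',B')$. -/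

import Mathlib

open Topology unitInterval

namespace NielsenPreimage

/-- `Y` is semilocally simply connected: every point `y` has a neighbourhood `U` such that every
loop at `y` inside `U` is null-homotopic in `Y`. -/
def SemilocallySimplyConnected (Y : Type*) [TopologicalSpace Y] : Prop :=
  ∀ y : Y, ∃ U ∈ 𝓝 y, ∀ γ : Path y y, (∀ t, γ t ∈ U) → γ.Homotopic (Path.refl y)

section Classes

variable {X Y : Type*} [TopologicalSpace X] [TopologicalSpace Y]

/-- Nielsen equivalence of points `x₀, x₁` of `f ⁻¹' B`: there are a path `α` in `X` from `x₀` to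
`x₁` and a path `β` in `B` from `f x₀` to `f x₁` such that `f ∘ α` and `β` are homotopic in `Y`
relative to end points. (The existence of `β` forces `x₀, x₁ ∈ f ⁻¹' B`.) -/
def NielsenEquiv (f : C(X, Y)) (B : Set Y) (x₀ x₁ : X) : Prop :=
  ∃ (α : Path x₀ x₁) (β : Path (f x₀) (f x₁)),
    (∀ t, β t ∈ B) ∧ (α.map f.continuous).Homotopic β

theorem NielsenEquiv.refl (f : C(X, Y)) (B : Set Y) {x : X} (hx : x ∈ f ⁻¹' B) :
    NielsenEquiv f B x x :=
  ⟨Path.refl x, Path.refl (f x), fun _ => hx, by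
    rw [show (Path.refl x).map f.continuous = Path.refl (f x) from rfl]⟩

theorem NielsenEquiv.symm {f : C(X, Y)} {B : Set Y} {x₀ x₁ : X} (h : NielsenEquiv f B x₀ x₁) :
    NielsenEquiv f B x₁ x₀ := by
  obtain ⟨α, β, hβ, h⟩ := h
  exact ⟨α.symm, β.symm, fun t => hβ (σ t), h.symm₂⟩

theorem NielsenEquiv.trans {f : C(X, Y)} {B : Set Y} {x₀ x₁ x₂ : X}
    (h : NielsenEquiv f B x₀ x₁) (h' : NielsenEquiv f B x₁ x₂) : NielsenEquiv f B x₀ x₂ := by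
  obtain ⟨α, β, hβ, h⟩ := h
  obtain ⟨α', β', hβ', h'⟩ := h'
  refine ⟨α.trans α', β.trans β', fun t => ?_, ?_⟩
  · rw [Path.trans_apply]
    split_ifs
    · exact hβ _
    · exact hβ' _
  · rw [Path.map_trans]
    exact h.hcomp h'

/-- `A` is a Nielsen (preimage) class of `f : X → Y ⊇ B`, i.e. an equivalence class of
`NielsenEquiv f B` on `f ⁻¹' B`. -/
def IsNielsenClass (f : C(X, Y)) (B : Set Y) (A : Set X) : Prop :=
  ∃ x₀ ∈ f ⁻¹' B, A = {x | NielsenEquiv f B x₀ x}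

/-- The path `t ↦ f_t (α t)` for a homotopy `F = {f_t}` and a path `α`. -/
def track {f₀ f₁ : C(X, Y)} (F : f₀.Homotopy f₁) {x₀ x₁ : X} (α : Path x₀ x₁) :
    Path (f₀ x₀) (f₁ x₁) where
  toFun t := F (t, α t)
  continuous_toFun := by fun_prop
  source' := by simp
  target' := by simp

/-- For a homotopy `F = {f_t}`, the point `x₀ ∈ f₀ ⁻¹' B` is `F`-related to `x₁ ∈ f₁ ⁻¹' B`: there
are a path `α` from `x₀` to `x₁` and a path `β` in `B` from `f₀ x₀` to `f₁ x₁` such that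
`t ↦ f_t (α t)` is homotopic to `β` in `Y` relative to end points. -/
def PointRelated {f₀ f₁ : C(X, Y)} (F : f₀.Homotopy f₁) (B : Set Y) (x₀ x₁ : X) : Prop :=
  ∃ (α : Path x₀ x₁) (β : Path (f₀ x₀) (f₁ x₁)),
    (∀ t, β t ∈ B) ∧ (track F α).Homotopic β

/-- The class `A₀` of `f₀` is `F`-related to the class `A₁` of `f₁`: some (equivalently, every)
point of `A₀` is `F`-related to some (equivalently, every) point of `A₁`. -/
def ClassRelated {f₀ f₁ : C(X, Y)} (F : f₀.Homotopy f₁) (B : Set Y) (A₀ A₁ : Set X) : Prop :=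
  ∃ x₀ ∈ A₀, ∃ x₁ ∈ A₁, PointRelated F B x₀ x₁

/-- A class `A₀` of `f` is topologically essential if for every homotopy `F` starting at `f` it is
`F`-related to some Nielsen class of the final map of `F`. -/
def IsEssential (f : C(X, Y)) (B : Set Y) (A₀ : Set X) : Prop :=
  ∀ (f₁ : C(X, Y)) (F : f.Homotopy f₁), ∃ A₁, IsNielsenClass f₁ B A₁ ∧ ClassRelated F B A₀ A₁

/-- The topological Nielsen number `N_t(f, B)`: the number (an integer or infinity) of
topologically essential Nielsen classes of `f : X → Y ⊇ B`. -/
noncomputable def nielsenNumber (f : C(X, Y)) (B : Set Y) : ℕ∞ :=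
  {A : Set X | IsNielsenClass f B A ∧ IsEssential f B A}.encard

end Classes

section Triples

variable {Y Y' : Type*} [TopologicalSpace Y] [TopologicalSpace Y']

/-- `g` is a map of triples `(Y, Y - B, B) → (Y', Y' - B', B')`. -/
def IsTripleMap (B : Set Y) (B' : Set Y') (g : C(Y, Y')) : Prop :=
  Set.MapsTo g B B' ∧ Set.MapsTo g Bᶜ B'ᶜ

/-- `ψ` is a homotopy equivalence of triples `(Y, Y - B, B) → (Y', Y' - B', B')`: it is a map of
triples and has a homotopy inverse `θ` that is a map of triples, both homotopies to the identity
being through maps of triples. -/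
def IsTripleHomotopyEquiv (B : Set Y) (B' : Set Y') (ψ : C(Y, Y')) : Prop :=
  IsTripleMap B B' ψ ∧ ∃ θ : C(Y', Y), IsTripleMap B' B θ ∧
    (θ.comp ψ).HomotopicWith (ContinuousMap.id Y) (IsTripleMap B B) ∧
    (ψ.comp θ).HomotopicWith (ContinuousMap.id Y') (IsTripleMap B' B')

/-- `ψ` is a homeomorphism of triples `(Y, Y - B, B) → (Y', Y' - B', B')`. -/
def IsTripleHomeomorph (B : Set Y) (B' : Set Y') (ψ : Y ≃ₜ Y') : Prop :=
  IsTripleMap B B' (ψ : C(Y, Y')) ∧ IsTripleMap B' B (ψ.symm : C(Y', Y))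

end Triples

end NielsenPreimage

/-! All conditions are read in the fundamental groupoid, as statements that a path class of `Y` has
a representative in `B`; naturality of homotopy trajectories does the computations. An essential
point stays related to an essential point along any homotopy, and related points determine each
other's classes, so N_t is homotopy invariant. Composing with `ψ` or `φ` gives one inequality
directly: homotopies of `f` induce homotopies of `ψ ∘ f` and `f ∘ φ`, but not conversely. The
reverse inequality applies the same argument to a homotopy inverse and uses homotopy invariance. -/

namespace Path.Homotopic.Quotient

/-! ### Groupoid calculus of path classes. -/

variable {X Y : Type*} [TopologicalSpace X] [TopologicalSpace Y] {x₀ x₁ x₂ : X}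

theorem symm_trans_rev (p : Path.Homotopic.Quotient x₀ x₁) (q : Path.Homotopic.Quotient x₁ x₂) :
    (p.trans q).symm = q.symm.trans p.symm := by
  induction p using Path.Homotopic.Quotient.ind with | mk p =>
  induction q using Path.Homotopic.Quotient.ind with | mk q =>
  rw [← mk_trans, ← mk_symm, Path.trans_symm]
  rfl

theorem map_trans (p : Path.Homotopic.Quotient x₀ x₁) (q : Path.Homotopic.Quotient x₁ x₂) (f : C(X, Y)) :
    (p.trans q).map f = (p.map f).trans (q.map f) := by
  induction p using Path.Homotopic.Quotient.ind with | mk p =>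
  induction q using Path.Homotopic.Quotient.ind with | mk q =>
  rw [← mk_trans, ← mk_map, Path.map_trans]
  rfl

theorem map_symm (p : Path.Homotopic.Quotient x₀ x₁) (f : C(X, Y)) : p.symm.map f = (p.map f).symm := by
  induction p using Path.Homotopic.Quotient.ind with | mk p => rfl

theorem map_id (p : Path.Homotopic.Quotient x₀ x₁) : p.map (ContinuousMap.id X) = p := by
  induction p using Path.Homotopic.Quotient.ind with | mk p => rfl

theorem trans_symm_cancel_left (p : Path.Homotopic.Quotient x₀ x₁) (q : Path.Homotopic.Quotient x₀ x₂) :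
    p.trans (p.symm.trans q) = q := by
  rw [← trans_assoc, trans_symm, refl_trans]

theorem symm_trans_cancel_left (p : Path.Homotopic.Quotient x₀ x₁) (q : Path.Homotopic.Quotient x₁ x₂) :
    p.symm.trans (p.trans q) = q := by
  rw [← trans_assoc, symm_trans, refl_trans]

/-- Naturality of the trajectories of a homotopy. -/
theorem map_trans_evalAt {f g : C(X, Y)} (F : f.Homotopy g) (p : Path.Homotopic.Quotient x₀ x₁) :
    (p.map f).trans (mk (F.evalAt x₁)) = (mk (F.evalAt x₀)).trans (p.map g) := by
  induction p using Path.Homotopic.Quotient.ind with | mk p =>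
  exact Path.Homotopic.Quotient.eq.2 (Path.Homotopic.map_trans_evalAt F p)

theorem trans_right_cancel {p q : Path.Homotopic.Quotient x₀ x₁}
    {r : Path.Homotopic.Quotient x₁ x₂} (h : p.trans r = q.trans r) : p = q := by
  have := congrArg (fun s => s.trans r.symm) h
  simpa using this

/-- By naturality `p` is `p.map g` conjugated by trajectories of `F`, so `p.map g` determines it. -/
theorem map_injective_of_homotopy_id {g : C(X, X)} (F : g.Homotopy (ContinuousMap.id X))
    {p q : Path.Homotopic.Quotient x₀ x₁} (h : p.map g = q.map g) : p = q := by
  have hp := map_trans_evalAt F p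
  rw [h, map_trans_evalAt F q, map_id, map_id] at hp
  have := congrArg (fun s => (mk (F.evalAt x₀)).symm.trans s) hp
  exact (symm_trans_cancel_left _ p).symm.trans (this.symm.trans (symm_trans_cancel_left _ q))

end Path.Homotopic.Quotient

namespace ContinuousMap.Homotopy

variable {X Y Z : Type*} [TopologicalSpace X] [TopologicalSpace Y] [TopologicalSpace Z]

theorem evalAt_trans {f g h : C(X, Y)} (F : f.Homotopy g) (G : g.Homotopy h) (x : X) :
    (F.trans G).evalAt x = (F.evalAt x).trans (G.evalAt x) := by
  ext t
  simp only [evalAt_apply, Homotopy.trans_apply, Path.trans_apply]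

theorem evalAt_refl_comp {f g : C(X, Y)} (F : f.Homotopy g) (k : C(Y, Z)) (x : X) :
    ((Homotopy.refl k).comp F).evalAt x = (F.evalAt x).map k.continuous := rfl

theorem evalAt_comp_refl {f g : C(Y, Z)} (F : f.Homotopy g) (k : C(X, Y)) (x : X) :
    (F.comp (Homotopy.refl k)).evalAt x = F.evalAt (k x) := rfl

end ContinuousMap.Homotopy

namespace NielsenPreimage

/-! ### Path classes represented inside the subspace. -/

section DeformsInto

variable {Y Y' : Type*} [TopologicalSpace Y] [TopologicalSpace Y'] {B : Set Y} {B' : Set Y'}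
  {y₀ y₁ y₂ : Y}

/-- A path class deforms into `B` if it is represented by a path in `B`. -/
def DeformsInto (B : Set Y) (q : Path.Homotopic.Quotient y₀ y₁) : Prop :=
  ∃ β : Path y₀ y₁, (∀ t, β t ∈ B) ∧ Path.Homotopic.Quotient.mk β = q

theorem DeformsInto.source_mem {q : Path.Homotopic.Quotient y₀ y₁} (h : DeformsInto B q) :
    y₀ ∈ B := by
  obtain ⟨β, hβ, -⟩ := h
  simpa using hβ 0

theorem DeformsInto.target_mem {q : Path.Homotopic.Quotient y₀ y₁} (h : DeformsInto B q) :
    y₁ ∈ B := by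
  obtain ⟨β, hβ, -⟩ := h
  simpa using hβ 1

theorem DeformsInto.symm {q : Path.Homotopic.Quotient y₀ y₁} (h : DeformsInto B q) :
    DeformsInto B q.symm := by
  obtain ⟨β, hβ, rfl⟩ := h
  exact ⟨β.symm, fun t => hβ (σ t), rfl⟩

theorem DeformsInto.trans {q : Path.Homotopic.Quotient y₀ y₁}
    {r : Path.Homotopic.Quotient y₁ y₂} (h : DeformsInto B q) (h' : DeformsInto B r) :
    DeformsInto B (q.trans r) := by
  obtain ⟨β, hβ, rfl⟩ := h
  obtain ⟨γ, hγ, rfl⟩ := h'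
  refine ⟨β.trans γ, fun t => ?_, rfl⟩
  rw [Path.trans_apply]
  split_ifs
  · exact hβ _
  · exact hγ _

theorem DeformsInto.map {q : Path.Homotopic.Quotient y₀ y₁} (h : DeformsInto B q) {g : C(Y, Y')}
    (hg : Set.MapsTo g B B') : DeformsInto B' (q.map g) := by
  obtain ⟨β, hβ, rfl⟩ := h
  exact ⟨β.map g.continuous, fun t => hg (hβ t), rfl⟩

theorem deformsInto_evalAt {g h : C(Y, Y')} (L : g.HomotopyWith h (IsTripleMap B B'))
    (hy : y₀ ∈ B) : DeformsInto B' (Path.Homotopic.Quotient.mk (L.toHomotopy.evalAt y₀)) :=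
  ⟨_, fun t => (L.prop t).1 hy, rfl⟩

/-- A homotopy equivalence of triples detects which path classes deform into the subspace. -/
theorem IsTripleHomotopyEquiv.deformsInto_map_iff {ψ : C(Y, Y')}
    (hψ : IsTripleHomotopyEquiv B B' ψ) (q : Path.Homotopic.Quotient y₀ y₁) :
    DeformsInto B' (q.map ψ) ↔ DeformsInto B q := by
  obtain ⟨hψ, θ, hθ, ⟨L⟩, -⟩ := hψ
  refine ⟨fun h => ?_, fun h => h.map hψ.1⟩
  -- The complement condition puts both end points in `B`, so the trajectories of `L` there stay in
  -- `B`.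
  have mem_of_map_mem : ∀ y, ψ y ∈ B' → y ∈ B := fun y hy => by
    by_contra hn
    exact hψ.2 hn hy
  have h₀ := deformsInto_evalAt L (mem_of_map_mem _ h.source_mem)
  have h₁ := deformsInto_evalAt L (mem_of_map_mem _ h.target_mem)
  have key := Path.Homotopic.Quotient.map_trans_evalAt L.toHomotopy q
  have h' : DeformsInto B (q.map (θ.comp ψ)) := by
    rw [Path.Homotopic.Quotient.map_comp]
    exact h.map hθ.1
  have := h₀.symm.trans (h'.trans h₁)
  rw [key, Path.Homotopic.Quotient.symm_trans_cancel_left, Path.Homotopic.Quotient.map_id] at this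
  exact this

end DeformsInto

/-! ### Nielsen relations in terms of path classes. -/

section Relations

variable {X Y : Type*} [TopologicalSpace X] [TopologicalSpace Y]

theorem nielsenEquiv_iff {f : C(X, Y)} {B : Set Y} {x₀ x₁ : X} :
    NielsenEquiv f B x₀ x₁ ↔
      ∃ a : Path.Homotopic.Quotient x₀ x₁, DeformsInto B (a.map f) := by
  constructor
  · rintro ⟨α, β, hβ, h⟩
    exact ⟨Path.Homotopic.Quotient.mk α, β, hβ, Path.Homotopic.Quotient.eq.2 h.symm⟩
  · rintro ⟨a, β, hβ, h⟩
    induction a using Path.Homotopic.Quotient.ind with | mk α =>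
    exact ⟨α, β, hβ, (Path.Homotopic.Quotient.eq.1 h).symm⟩

/-- In `I × X` the diagonal path `(t, α t)` deforms to `α` at time 0 followed by the time segment
over `x₁`; then `F` is applied. -/
theorem track_homotopic {f₀ f₁ : C(X, Y)} (F : f₀.Homotopy f₁) {x₀ x₁ : X} (α : Path x₀ x₁) :
    (track F α).Homotopic ((α.map f₀.continuous).trans (F.evalAt x₁)) := by
  have h : (Path.id.prod α).Homotopic
      (((Path.refl (0 : I)).trans Path.id).prod (α.trans (Path.refl x₁))) :=
    ⟨Path.Homotopic.prodHomotopy (.symm <| .reflTrans _) (.symm <| .transRefl _)⟩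
  obtain ⟨H⟩ := h.map F.toContinuousMap
  refine ⟨(H.pathCast (F.apply_zero x₀).symm (F.apply_one x₁).symm).cast ?_ ?_⟩
  · ext t
    rfl
  · ext t
    simp only [Path.trans_apply, Path.map_coe, Path.cast_coe, Function.comp_apply, Path.prod_coe]
    split_ifs <;> simp

theorem pointRelated_iff {f₀ f₁ : C(X, Y)} {F : f₀.Homotopy f₁} {B : Set Y} {x₀ x₁ : X} :
    PointRelated F B x₀ x₁ ↔ ∃ a : Path.Homotopic.Quotient x₀ x₁,
      DeformsInto B ((a.map f₀).trans (Path.Homotopic.Quotient.mk (F.evalAt x₁))) := by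
  have key (α : Path x₀ x₁) : Path.Homotopic.Quotient.mk (track F α) =
      ((Path.Homotopic.Quotient.mk α).map f₀).trans (Path.Homotopic.Quotient.mk (F.evalAt x₁)) :=
    Path.Homotopic.Quotient.eq.2 (track_homotopic F α)
  constructor
  · rintro ⟨α, β, hβ, h⟩
    exact ⟨Path.Homotopic.Quotient.mk α, β, hβ, (Path.Homotopic.Quotient.eq.2 h.symm).trans (key α)⟩
  · rintro ⟨a, β, hβ, h⟩
    induction a using Path.Homotopic.Quotient.ind with | mk α =>
    exact ⟨α, β, hβ, (Path.Homotopic.Quotient.eq.1 (h.trans (key α).symm)).symm⟩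

theorem PointRelated.target_mem {f₀ f₁ : C(X, Y)} {F : f₀.Homotopy f₁} {B : Set Y} {x₀ x₁ : X}
    (h : PointRelated F B x₀ x₁) : x₁ ∈ f₁ ⁻¹' B := by
  obtain ⟨a, ha⟩ := pointRelated_iff.1 h
  exact ha.target_mem

theorem NielsenEquiv.trans_pointRelated {f₀ f₁ : C(X, Y)} {F : f₀.Homotopy f₁} {B : Set Y}
    {x y z : X} (h : NielsenEquiv f₀ B x y) (h' : PointRelated F B y z) :
    PointRelated F B x z := by
  obtain ⟨a, ha⟩ := nielsenEquiv_iff.1 h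
  obtain ⟨b, hb⟩ := pointRelated_iff.1 h'
  refine pointRelated_iff.2 ⟨a.trans b, ?_⟩
  rw [Path.Homotopic.Quotient.map_trans, Path.Homotopic.Quotient.trans_assoc]
  exact ha.trans hb

theorem PointRelated.trans_nielsenEquiv {f₀ f₁ : C(X, Y)} {F : f₀.Homotopy f₁} {B : Set Y}
    {x y z : X} (h : PointRelated F B x y) (h' : NielsenEquiv f₁ B y z) :
    PointRelated F B x z := by
  obtain ⟨a, ha⟩ := pointRelated_iff.1 h
  obtain ⟨b, hb⟩ := nielsenEquiv_iff.1 h'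
  refine pointRelated_iff.2 ⟨a.trans b, ?_⟩
  rw [Path.Homotopic.Quotient.map_trans, Path.Homotopic.Quotient.trans_assoc, Path.Homotopic.Quotient.map_trans_evalAt,
    ← Path.Homotopic.Quotient.trans_assoc]
  exact ha.trans hb

theorem PointRelated.nielsenEquiv {f₀ f₁ : C(X, Y)} {F : f₀.Homotopy f₁} {B : Set Y}
    {x y z : X} (h : PointRelated F B x z) (h' : PointRelated F B y z) :
    NielsenEquiv f₀ B x y := by
  obtain ⟨a, ha⟩ := pointRelated_iff.1 h
  obtain ⟨b, hb⟩ := pointRelated_iff.1 h'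
  refine nielsenEquiv_iff.2 ⟨a.trans b.symm, ?_⟩
  have := ha.trans hb.symm
  rwa [Path.Homotopic.Quotient.symm_trans_rev, Path.Homotopic.Quotient.trans_assoc, Path.Homotopic.Quotient.trans_symm_cancel_left,
    ← Path.Homotopic.Quotient.map_symm, ← Path.Homotopic.Quotient.map_trans] at this

/-- By naturality both classes begin with the trajectory of `F` at `x`, which cancels when the first
is inverted and composed with the second. -/
theorem PointRelated.of_trans {f g h : C(X, Y)} {F : f.Homotopy g} {G : g.Homotopy h} {B : Set Y}
    {x y z : X} (hF : PointRelated F B x y) (hFG : PointRelated (F.trans G) B x z) :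
    PointRelated G B y z := by
  obtain ⟨a, ha⟩ := pointRelated_iff.1 hF
  obtain ⟨b, hb⟩ := pointRelated_iff.1 hFG
  refine pointRelated_iff.2 ⟨a.symm.trans b, ?_⟩
  have := ha.symm.trans hb
  rwa [ContinuousMap.Homotopy.evalAt_trans, Path.Homotopic.Quotient.mk_trans, Path.Homotopic.Quotient.map_trans_evalAt,
    ← Path.Homotopic.Quotient.trans_assoc (b.map f), Path.Homotopic.Quotient.map_trans_evalAt, Path.Homotopic.Quotient.symm_trans_rev,
    Path.Homotopic.Quotient.trans_assoc, Path.Homotopic.Quotient.trans_assoc, Path.Homotopic.Quotient.symm_trans_cancel_left,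
    ← Path.Homotopic.Quotient.map_symm, ← Path.Homotopic.Quotient.trans_assoc, ← Path.Homotopic.Quotient.map_trans] at this

/-- A point of `f ⁻¹' B` that is related to some point under every homotopy starting at `f`. -/
def IsEssentialPoint (f : C(X, Y)) (B : Set Y) (x : X) : Prop :=
  x ∈ f ⁻¹' B ∧ ∀ (f₁ : C(X, Y)) (F : f.Homotopy f₁), ∃ x₁, PointRelated F B x x₁

/-- Relatedness depends only on the Nielsen class of the starting point, so one representative
suffices. -/
theorem isEssential_iff {f : C(X, Y)} {B : Set Y} {x : X} (hx : x ∈ f ⁻¹' B) :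
    IsEssential f B {y | NielsenEquiv f B x y} ↔ IsEssentialPoint f B x := by
  constructor
  · refine fun h => ⟨hx, fun f₁ F => ?_⟩
    obtain ⟨A₁, -, y, hy, z, -, hyz⟩ := h f₁ F
    exact ⟨z, NielsenEquiv.trans_pointRelated hy hyz⟩
  · rintro ⟨-, h⟩ f₁ F
    obtain ⟨z, hz⟩ := h f₁ F
    exact ⟨_, ⟨z, hz.target_mem, rfl⟩, x, .refl f B hx, z, .refl f₁ B hz.target_mem, hz⟩

end Relations

/-! ### Comparison of Nielsen numbers. -/

section Comparison

variable {X X' Y Y' : Type*} [TopologicalSpace X] [TopologicalSpace X'] [TopologicalSpace Y]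
  [TopologicalSpace Y']

/-- Choosing an `R`-partner for a representative of each essential class gives an injection of
essential classes; `R` itself need not be a function. -/
theorem nielsenNumber_le_of_relation {f : C(X, Y)} {f' : C(X', Y')} {B : Set Y} {B' : Set Y'}
    (R : X → X' → Prop)
    (hR : ∀ x, IsEssentialPoint f B x → ∃ x', IsEssentialPoint f' B' x' ∧ R x x')
    (hinj : ∀ x y x' y', R x x' → R y y' → NielsenEquiv f' B' x' y' → NielsenEquiv f B x y) :
    nielsenNumber f B ≤ nielsenNumber f' B' := by
  have hex : ∀ A : {A : Set X | IsNielsenClass f B A ∧ IsEssential f B A}, ∃ x x',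
      A.1 = {y | NielsenEquiv f B x y} ∧ IsEssentialPoint f' B' x' ∧ R x x' := by
    rintro ⟨A, ⟨x, hx, rfl⟩, hA⟩
    obtain ⟨x', hx', hxx'⟩ := hR x ((isEssential_iff hx).1 hA)
    exact ⟨x, x', rfl, hx', hxx'⟩
  choose p p' hp hp' hpp' using hex
  let g : {A : Set X | IsNielsenClass f B A ∧ IsEssential f B A} →
      {A : Set X' | IsNielsenClass f' B' A ∧ IsEssential f' B' A} := fun A =>
    ⟨{y | NielsenEquiv f' B' (p' A) y}, ⟨p' A, (hp' A).1, rfl⟩,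
      (isEssential_iff (hp' A).1).2 (hp' A)⟩
  refine Function.Embedding.encard_le ⟨g, fun A A' h => Subtype.ext ?_⟩
  have h' : {y | NielsenEquiv f' B' (p' A) y} = {y | NielsenEquiv f' B' (p' A') y} :=
    congrArg Subtype.val h
  have hmem : p' A' ∈ {y | NielsenEquiv f' B' (p' A) y} :=
    h' ▸ NielsenEquiv.refl f' B' (hp' A').1
  have heq := hinj _ _ _ _ (hpp' A) (hpp' A') hmem
  rw [hp A, hp A']
  ext y
  exact ⟨heq.symm.trans, heq.trans⟩

theorem nielsenNumber_le_of_homotopy {f g : C(X, Y)} (F : f.Homotopy g) (B : Set Y) :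
    nielsenNumber f B ≤ nielsenNumber g B := by
  refine nielsenNumber_le_of_relation (PointRelated F B) (fun x hx => ?_)
    fun x y x' y' h h' e => (h.trans_nielsenEquiv e).nielsenEquiv h'
  obtain ⟨x', hx'⟩ := hx.2 g F
  refine ⟨x', ⟨hx'.target_mem, fun h G => ?_⟩, hx'⟩
  -- Essentiality of `x` is tested on `F` followed by `G`.
  obtain ⟨z, hz⟩ := hx.2 h (F.trans G)
  exact ⟨z, hx'.of_trans hz⟩

/-- Homotopy invariance of the topological Nielsen number. -/
theorem nielsenNumber_eq_of_homotopic {f g : C(X, Y)} (h : f.Homotopic g) (B : Set Y) :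
    nielsenNumber f B = nielsenNumber g B := by
  obtain ⟨F⟩ := h
  exact le_antisymm (nielsenNumber_le_of_homotopy F B) (nielsenNumber_le_of_homotopy F.symm B)

theorem IsTripleHomotopyEquiv.nielsenNumber_comp_le {B : Set Y} {B' : Set Y'} {ψ : C(Y, Y')}
    (hψ : IsTripleHomotopyEquiv B B' ψ) (f : C(X, Y)) :
    nielsenNumber (ψ.comp f) B' ≤ nielsenNumber f B := by
  refine nielsenNumber_le_of_relation Eq (fun x hx => ⟨x, ⟨?_, fun f₁ F => ?_⟩, rfl⟩) ?_
  · by_contra hn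
    exact hψ.1.2 hn hx.1
  · obtain ⟨z, hz⟩ := hx.2 _ ((ContinuousMap.Homotopy.refl ψ).comp F)
    obtain ⟨a, ha⟩ := pointRelated_iff.1 hz
    -- The point is unchanged; `ψ` detects which classes deform into `B`.
    refine ⟨z, pointRelated_iff.2 ⟨a, (hψ.deformsInto_map_iff _).1 ?_⟩⟩
    rwa [ContinuousMap.Homotopy.evalAt_refl_comp, Path.Homotopic.Quotient.map_comp, Path.Homotopic.Quotient.mk_map,
      ← Path.Homotopic.Quotient.map_trans] at ha
  · rintro x y _ _ rfl rfl h
    obtain ⟨a, ha⟩ := nielsenEquiv_iff.1 h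
    refine nielsenEquiv_iff.2 ⟨a, ?_⟩
    rw [Path.Homotopic.Quotient.map_comp]
    exact ha.map hψ.1.1

theorem IsTripleHomotopyEquiv.nielsenNumber_comp {B : Set Y} {B' : Set Y'} {ψ : C(Y, Y')}
    (hψ : IsTripleHomotopyEquiv B B' ψ) (f : C(X, Y)) :
    nielsenNumber (ψ.comp f) B' = nielsenNumber f B := by
  refine le_antisymm (hψ.nielsenNumber_comp_le f) ?_
  obtain ⟨hψ, θ, hθ, hL, hL'⟩ := hψ
  have hθ' : IsTripleHomotopyEquiv B' B θ := ⟨hθ, ψ, hψ, hL', hL⟩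
  obtain ⟨L⟩ := hL
  have h : ((θ.comp ψ).comp f).Homotopic f :=
    ⟨L.toHomotopy.comp (ContinuousMap.Homotopy.refl f)⟩
  rw [← nielsenNumber_eq_of_homotopic h]
  exact hθ'.nielsenNumber_comp_le (ψ.comp f)

theorem exists_quotient_map_eq (φ : ContinuousMap.HomotopyEquiv X X') {x₀ x₁ : X}
    (q : Path.Homotopic.Quotient (φ.toFun x₀) (φ.toFun x₁)) :
    ∃ a : Path.Homotopic.Quotient x₀ x₁, a.map φ.toFun = q := by
  obtain ⟨L⟩ := φ.left_inv
  obtain ⟨R⟩ := φ.right_inv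
  -- Conjugation by the trajectories of `L` is chosen so that `φ.invFun` sends `a.map φ.toFun` and
  -- `q` to the same class.
  let a : Path.Homotopic.Quotient x₀ x₁ := (Path.Homotopic.Quotient.mk (L.evalAt x₀)).symm.trans
    ((q.map φ.invFun).trans (Path.Homotopic.Quotient.mk (L.evalAt x₁)))
  refine ⟨a, Path.Homotopic.Quotient.map_injective_of_homotopy_id R (g := φ.toFun.comp φ.invFun) ?_⟩
  have h : (a.map (φ.invFun.comp φ.toFun)).trans (Path.Homotopic.Quotient.mk (L.evalAt x₁)) =
      (q.map φ.invFun).trans (Path.Homotopic.Quotient.mk (L.evalAt x₁)) := by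
    rw [Path.Homotopic.Quotient.map_trans_evalAt, Path.Homotopic.Quotient.map_id]
    exact Path.Homotopic.Quotient.trans_symm_cancel_left _ _
  rw [Path.Homotopic.Quotient.map_comp] at h
  have h' := Path.Homotopic.Quotient.trans_right_cancel h
  rw [Path.Homotopic.Quotient.map_comp, Path.Homotopic.Quotient.map_comp, h']

theorem nielsenNumber_comp_homotopyEquiv_le (φ : ContinuousMap.HomotopyEquiv X X')
    (f : C(X', Y)) (B : Set Y) : nielsenNumber (f.comp φ.toFun) B ≤ nielsenNumber f B := by
  refine nielsenNumber_le_of_relation (fun x x' => x' = φ.toFun x)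
    (fun x hx => ⟨_, ⟨hx.1, fun f₁ F => ?_⟩, rfl⟩) ?_
  · obtain ⟨z, hz⟩ := hx.2 _ (F.comp (ContinuousMap.Homotopy.refl φ.toFun))
    obtain ⟨a, ha⟩ := pointRelated_iff.1 hz
    refine ⟨φ.toFun z, pointRelated_iff.2 ⟨a.map φ.toFun, ?_⟩⟩
    rwa [ContinuousMap.Homotopy.evalAt_comp_refl, Path.Homotopic.Quotient.map_comp] at ha
  · rintro x y _ _ rfl rfl h
    obtain ⟨q, hq⟩ := nielsenEquiv_iff.1 h
    -- A path class in `X'` between image points must be lifted to `X`, hence fullness of `φ` on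
    -- path classes.
    obtain ⟨a, rfl⟩ := exists_quotient_map_eq φ q
    exact nielsenEquiv_iff.2 ⟨a, by rwa [Path.Homotopic.Quotient.map_comp]⟩

theorem nielsenNumber_comp_homotopyEquiv (φ : ContinuousMap.HomotopyEquiv X X')
    (f : C(X', Y)) (B : Set Y) : nielsenNumber (f.comp φ.toFun) B = nielsenNumber f B := by
  refine le_antisymm (nielsenNumber_comp_homotopyEquiv_le φ f B) ?_
  obtain ⟨R⟩ := φ.right_inv
  have h : (f.comp (φ.toFun.comp φ.invFun)).Homotopic f :=
    ⟨(ContinuousMap.Homotopy.refl f).comp R⟩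
  rw [← nielsenNumber_eq_of_homotopic h]
  exact nielsenNumber_comp_homotopyEquiv_le φ.symm (f.comp φ.toFun) B

theorem IsTripleHomeomorph.isTripleHomotopyEquiv {B : Set Y} {B' : Set Y'} {ψ : Y ≃ₜ Y'}
    (hψ : IsTripleHomeomorph B B' ψ) : IsTripleHomotopyEquiv B B' (ψ : C(Y, Y')) := by
  refine ⟨hψ.1, _, hψ.2, ?_, ?_⟩
  · rw [Homeomorph.symm_comp_toContinuousMap]
    exact .refl _ ⟨fun _ h => h, fun _ h => h⟩
  · rw [Homeomorph.toContinuousMap_comp_symm]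
    exact .refl _ ⟨fun _ h => h, fun _ h => h⟩

/-- Homotopy type invariance of the topological Nielsen number. -/
theorem nielsenNumber_eq_of_homotopyEquiv {f : C(X, Y)} {f' : C(X', Y')} {B : Set Y} {B' : Set Y'}
    (φ : ContinuousMap.HomotopyEquiv X X') {ψ : C(Y, Y')} (hψ : IsTripleHomotopyEquiv B B' ψ)
    (h : (ψ.comp f).Homotopic (f'.comp φ.toFun)) : nielsenNumber f B = nielsenNumber f' B' := by
  rw [← hψ.nielsenNumber_comp, nielsenNumber_eq_of_homotopic h, nielsenNumber_comp_homotopyEquiv]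

end Comparison

end NielsenPreimage

theorem mainTheorem3 {X X' Y Y' : Type*}
    [TopologicalSpace X] [T2Space X] [ConnectedSpace X] [LocallyPathConnectedSpace X]
    [TopologicalSpace X'] [T2Space X'] [ConnectedSpace X'] [LocallyPathConnectedSpace X']
    [TopologicalSpace Y] [T2Space Y] [ConnectedSpace Y] [LocallyPathConnectedSpace Y]
    [TopologicalSpace Y'] [T2Space Y'] [ConnectedSpace Y'] [LocallyPathConnectedSpace Y']
    (hY : NielsenPreimage.SemilocallySimplyConnected Y)
    (hY' : NielsenPreimage.SemilocallySimplyConnected Y')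
    (B : Set Y) (hB : B.Nonempty) (B' : Set Y') (hB' : B'.Nonempty)
    (f : C(X, Y)) (f' : C(X', Y')) :
    (∀ (φ : ContinuousMap.HomotopyEquiv X X') (ψ : C(Y, Y')),
      NielsenPreimage.IsTripleHomotopyEquiv B B' ψ →
      (ψ.comp f).Homotopic (f'.comp φ.toFun) →
      NielsenPreimage.nielsenNumber f B = NielsenPreimage.nielsenNumber f' B') ∧
    (∀ (φ : X ≃ₜ X') (ψ : Y ≃ₜ Y'),
      NielsenPreimage.IsTripleHomeomorph B B' ψ →
      (∀ x, ψ (f x) = f' (φ x)) →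
      NielsenPreimage.nielsenNumber f B = NielsenPreimage.nielsenNumber f' B') := by
  exact
    ⟨fun φ _ hψ h => NielsenPreimage.nielsenNumber_eq_of_homotopyEquiv φ hψ h,
      fun φ ψ hψ h => NielsenPreimage.nielsenNumber_eq_of_homotopyEquiv φ.toHomotopyEquiv
        hψ.isTripleHomotopyEquiv
        (by rw [show (ψ : C(Y, Y')).comp f = f'.comp φ.toHomotopyEquiv.toFun from
          ContinuousMap.ext h])⟩
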